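/- **Theorem (orthogonality testing).** Let $|\psi_1\rangle,|\psi_2\rangle\in\mathbb{C}^d$ be unknown pure states (unit vectors) of the same dimension, with the promise that either $|\langle\psi_1|\psi_2\rangle|^2=0$ or $|\langle\psi_1|\psi_2\rangle|^2\ge w$, where $0<w\le 1$. An orthogonality tester with error $\varepsilon$ using $n_1$ copies of $|\psi_1\rangle$ and $n_2$ copies of $|\psi_2\rangle$ is a two-outcome quantum measurement (POVM) on $(\mathbb{C}^d)^{\otimes n_1}\otimes(\mathbb{C}^d)^{\otimes n_2}$, not depending on the states, which, applied to $|\psi_1\rangle^{\otimes n_1}\otimes|\psi_2\rangle^{\otimes n_2}$, identifies which case holds with probability at least $1-\varepsilon$, for all pairs of states satisfying the promise. Then orthogonality testing with error $\varepsilon$ takes $\Theta(\log(1/\varepsilon)/w)$ copies of $|\psi_1\rangle$ and $|\psi_2\rangle$. Precisely: 1. (Upper bound) There is an absolute constant $C>0$ such that for all $0<w\le 1$ and $0<\varepsilon<1$ there is an integer $n\ge 0$ with $n\le C\log(1/\varepsilon)/w$ such that, in every dimension $d$, there is an orthogonality tester with error $\varepsilon$ using $n$ copies of each of the two states. 2.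 (Lower bound, total) For every $0<\varepsilon_0<1/2$ there is a constant $c>0$ such that for all $d\ge 2$, $0<w\le 1$ and $0<\varepsilon\le\varepsilon_0$, every orthogonality tester with error $\varepsilon$ using $n_1$ and $n_2$ copies satisfies $n_1+n_2\ge c\log(1/\varepsilon)/w$. 3. (Lower bound, each state) For every $0<\varepsilon_0<1/2$ and $0<w_0<1$ there is a constant $c>0$ such that for all $d\ge 2$, $0<w\le w_0$ and $0<\varepsilon\le\varepsilon_0$, every orthogonality tester with error $\varepsilon$ using $n_1$ and $n_2$ copies satisfies $n_1\ge c\log(1/\varepsilon)/w$ and $n_2\ge c\log(1/\varepsilon)/w$. -/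

import Mathlib

open scoped ComplexOrder

/-- A two-outcome quantum measurement (POVM) on the Hilbert space `ℂ^ι`.  Every procedure that
processes a quantum state (with ancillas, unitaries, channels, adaptive intermediate measurements,
classical randomness) and outputs one bit is described by such a measurement of its input. -/
structure BinaryMeasurement (ι : Type*) [Fintype ι] [DecidableEq ι] where
  effect : Bool → Matrix ι ι ℂ
  posSemidef : ∀ b, (effect b).PosSemidef
  sum_eq_one : ∑ b, effect b = 1

/-- Born rule: the probability `⟨v| M_b |v⟩` of the outcome `b` on the pure state `v`. -/
noncomputable def BinaryMeasurement.prob {ι : Type*} [Fintype ι] [DecidableEq ι]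
    (M : BinaryMeasurement ι) (b : Bool) (v : EuclideanSpace ℂ ι) : ℝ :=
  (star v.ofLp ⬝ᵥ Matrix.mulVec (M.effect b) v.ofLp).re

/-- The computational basis of `(ℂ^d)^{⊗ n₁} ⊗ (ℂ^d)^{⊗ n₂}`. -/
abbrev CopyIndex (d n₁ n₂ : ℕ) : Type := (Fin n₁ → Fin d) × (Fin n₂ → Fin d)

/-- The joint state `|ψ₁⟩^{⊗ n₁} ⊗ |ψ₂⟩^{⊗ n₂}`, in coordinates. -/
noncomputable def copies {d : ℕ} (n₁ n₂ : ℕ) (ψ₁ ψ₂ : EuclideanSpace ℂ (Fin d)) :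
    EuclideanSpace ℂ (CopyIndex d n₁ n₂) :=
  WithLp.toLp 2 fun x => (∏ i, ψ₁ (x.1 i)) * ∏ j, ψ₂ (x.2 j)

/-- `M` decides orthogonality in dimension `d` from `n₁` copies of `ψ₁` and `n₂` copies of `ψ₂`,
with threshold `w` and error probability at most `ε`: for all pure states `ψ₁`, `ψ₂`, it answers
`false` with probability at least `1 - ε` if `ψ₁ ⊥ ψ₂`, and `true` with probability at least
`1 - ε` if `|⟨ψ₁|ψ₂⟩|² ≥ w`. -/
def BinaryMeasurement.TestsOrthogonality {d n₁ n₂ : ℕ}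
    (M : BinaryMeasurement (CopyIndex d n₁ n₂)) (w ε : ℝ) : Prop :=
  ∀ ψ₁ ψ₂ : EuclideanSpace ℂ (Fin d), ‖ψ₁‖ = 1 → ‖ψ₂‖ = 1 →
    (‖inner ℂ ψ₁ ψ₂‖ = 0 → 1 - ε ≤ M.prob false (copies n₁ n₂ ψ₁ ψ₂)) ∧
    (w ≤ ‖inner ℂ ψ₁ ψ₂‖ ^ 2 → 1 - ε ≤ M.prob true (copies n₁ n₂ ψ₁ ψ₂))

/-- Orthogonality testing in dimension `d` with threshold `w` and error `ε` is possible with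
`n₁` copies of the first state and `n₂` copies of the second.  The measurement is chosen before
the states, which are unknown to it. -/
def OrthogonalityTestable (d n₁ n₂ : ℕ) (w ε : ℝ) : Prop :=
  ∃ M : BinaryMeasurement (CopyIndex d n₁ n₂), M.TestsOrthogonality w ε

open Matrix

/-! ### Two-outcome measurements: distinguishability bounds and spectral thresholds. -/

section Measurement

variable {ι κ : Type*} [Fintype ι] [DecidableEq ι] [Fintype κ] [DecidableEq κ]

/-! Upper bound: let S be the sum of all n² exchanges of a copy of ψ₁ with a copy of ψ₂, and a =
|⟨ψ₁|ψ₂⟩|². On the joint state, S has mean n²a and variance at most n²(1 + 2na). For orthogonal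
states the deviation is only n, against a shift of at least n²w in the other case, so n of order 1/w
suffices (swap tests on n disjoint pairs would have deviation √n against nw, hence need order 1/w²).
Measuring whether S ≥ n²w/2 has error at most 1/64 by Chebyshev (`exists_weak_tester`), and a
majority vote over about log(1/ε) blocks lowers the error to ε (`prob_majority_le`).

Lower bound: states told apart with error ε have squared overlap at most 4ε(1 - ε). Rotating one
vector of an orthonormal pair towards the other gives a pair to be accepted whose joint state has
squared overlap (1 - w)^n with the orthogonal one, n counting copies of the rotated state
(`pow_le`). This degenerates as w tends to 1; there, moving both vectors to their bisector gives
(1/2)^(n₁ + n₂) (`half_pow_le`). -/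

theorem Matrix.PosSemidef.exists_eq_conjTranspose_mul_self {A : Matrix ι ι ℂ}
    (hA : A.PosSemidef) : ∃ B : Matrix ι ι ℂ, A = Bᴴ * B := by
  open scoped MatrixOrder in
  exact CStarAlgebra.nonneg_iff_eq_star_mul_self.mp hA.nonneg

omit [DecidableEq ι] in
theorem star_dotProduct_conjTranspose_mul_self_mulVec (B : Matrix ι ι ℂ) (u v : ι → ℂ) :
    star u ⬝ᵥ ((Bᴴ * B) *ᵥ v) = inner ℂ (WithLp.toLp 2 (B *ᵥ u)) (WithLp.toLp 2 (B *ᵥ v)) := by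
  rw [EuclideanSpace.inner_toLp_toLp, ← mulVec_mulVec, dotProduct_mulVec, ← star_mulVec,
    dotProduct_comm]

namespace BinaryMeasurement

theorem prob_eq_norm_sq (M : BinaryMeasurement ι) {b : Bool} {B : Matrix ι ι ℂ}
    (h : M.effect b = Bᴴ * B) (v : EuclideanSpace ℂ ι) :
    M.prob b v = ‖WithLp.toLp 2 (B *ᵥ v.ofLp)‖ ^ 2 := by
  rw [prob, h, star_dotProduct_conjTranspose_mul_self_mulVec, inner_self_eq_norm_sq_to_K]
  norm_cast

theorem prob_false_add_prob_true (M : BinaryMeasurement ι) (v : EuclideanSpace ℂ ι) :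
    M.prob false v + M.prob true v = ‖v‖ ^ 2 := by
  have h := M.sum_eq_one
  rw [Fintype.sum_bool, add_comm] at h
  rw [prob, prob, ← Complex.add_re, ← dotProduct_add, ← add_mulVec, h, one_mulVec,
    dotProduct_comm, ← EuclideanSpace.inner_eq_star_dotProduct, inner_self_eq_norm_sq_to_K]
  norm_cast

theorem prob_nonneg (M : BinaryMeasurement ι) (b : Bool) (v : EuclideanSpace ℂ ι) :
    0 ≤ M.prob b v := by
  obtain ⟨B, hB⟩ := (M.posSemidef b).exists_eq_conjTranspose_mul_self
  rw [M.prob_eq_norm_sq hB]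
  positivity

/-- The effects sum to 1, so the inner product splits over the outcomes; factoring each effect as Bᴴ
* B, Cauchy–Schwarz bounds each part. -/
theorem norm_inner_le_sqrt_prob (M : BinaryMeasurement ι) (u v : EuclideanSpace ℂ ι) :
    ‖inner ℂ u v‖ ≤ √(M.prob false u) * √(M.prob false v) +
      √(M.prob true u) * √(M.prob true v) := by
  choose B hB using fun b => (M.posSemidef b).exists_eq_conjTranspose_mul_self
  have h := M.sum_eq_one
  rw [Fintype.sum_bool, add_comm] at h
  have key : inner ℂ u v = inner ℂ (WithLp.toLp 2 (B false *ᵥ u.ofLp))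
      (WithLp.toLp 2 (B false *ᵥ v.ofLp)) + inner ℂ (WithLp.toLp 2 (B true *ᵥ u.ofLp))
      (WithLp.toLp 2 (B true *ᵥ v.ofLp)) := by
    rw [← star_dotProduct_conjTranspose_mul_self_mulVec,
      ← star_dotProduct_conjTranspose_mul_self_mulVec, ← dotProduct_add, ← add_mulVec,
      ← hB, ← hB, h, one_mulVec, dotProduct_comm, EuclideanSpace.inner_eq_star_dotProduct]
  simp only [M.prob_eq_norm_sq (hB _), Real.sqrt_sq (norm_nonneg _)]
  rw [key]
  exact (norm_add_le _ _).trans (add_le_add (norm_inner_le_norm _ _) (norm_inner_le_norm _ _))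

/-- Two states told apart with error `ε ≤ 1/2` have squared overlap at most `4ε(1 - ε)`. -/
theorem norm_inner_sq_le_of_distinguishes (M : BinaryMeasurement ι) {u v : EuclideanSpace ℂ ι}
    (hu : ‖u‖ = 1) (hv : ‖v‖ = 1) {ε : ℝ} (hε : ε ≤ 1 / 2)
    (h₀ : 1 - ε ≤ M.prob false u) (h₁ : 1 - ε ≤ M.prob true v) :
    ‖inner ℂ u v‖ ^ 2 ≤ 4 * ε * (1 - ε) := by
  have hsu := M.prob_false_add_prob_true u
  have hsv := M.prob_false_add_prob_true v
  have hle := M.norm_inner_le_sqrt_prob u v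
  rw [hu] at hsu
  rw [hv] at hsv
  have a1 := Real.sq_sqrt (M.prob_nonneg false u)
  have a2 := Real.sq_sqrt (M.prob_nonneg true u)
  have b1 := Real.sq_sqrt (M.prob_nonneg false v)
  have b2 := Real.sq_sqrt (M.prob_nonneg true v)
  have pa1 := Real.sqrt_nonneg (M.prob false u)
  have pa2 := Real.sqrt_nonneg (M.prob true u)
  have pb1 := Real.sqrt_nonneg (M.prob false v)
  have pb2 := Real.sqrt_nonneg (M.prob true v)
  have hmain : 1 - ε ≤ √(M.prob false u) * √(M.prob true v) := by
    rw [← Real.sqrt_mul (M.prob_nonneg false u)]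
    apply Real.le_sqrt_of_sq_le
    nlinarith
  have hrest : √(M.prob true u) * √(M.prob false v) ≤ ε := by
    have : 0 ≤ ε := by linarith [M.prob_nonneg true u]
    rw [← Real.sqrt_mul (M.prob_nonneg true u)]
    apply Real.sqrt_le_iff.mpr ⟨this, ?_⟩
    nlinarith [M.prob_nonneg true u, M.prob_nonneg false v]
  generalize √(M.prob false u) = α at *
  generalize √(M.prob true u) = α' at *
  generalize √(M.prob false v) = β at *
  generalize √(M.prob true v) = β' at *
  -- Lagrange's identity for the unit vectors (α, α') and (β, β') of the plane: cos² + sin² = 1. The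
  -- sine is at least 1 - 2ε, so cos² ≤ 1 - (1 - 2ε)² = 4ε(1 - ε).
  have hunit : (α * β + α' * β') ^ 2 + (α * β' - α' * β) ^ 2 = 1 := by
    have : (α * β + α' * β') ^ 2 + (α * β' - α' * β) ^ 2
      = (α ^ 2 + α' ^ 2) * (β ^ 2 + β' ^ 2) := by ring
    rw [this, a1, a2, b1, b2, hsu, hsv]; norm_num
  have hd : 1 - 2 * ε ≤ α * β' - α' * β := by linarith
  have hsq : ‖inner ℂ u v‖ ^ 2 ≤ (α * β + α' * β') ^ 2 := by gcongr
  nlinarith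

/-- Transport of a measurement along a relabelling of the basis. -/
def reindex (M : BinaryMeasurement κ) (e : ι ≃ κ) : BinaryMeasurement ι where
  effect b := (M.effect b).submatrix e e
  posSemidef b := (M.posSemidef b).submatrix e
  sum_eq_one := by
    have h := M.sum_eq_one
    rw [Fintype.sum_bool] at h ⊢
    rw [← Matrix.submatrix_one_equiv e, ← h]
    rfl

theorem prob_reindex (M : BinaryMeasurement κ) (e : ι ≃ κ) (b : Bool) (v : EuclideanSpace ℂ κ) :
    (M.reindex e).prob b (WithLp.toLp 2 (v.ofLp ∘ e)) = M.prob b v := by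
  simp only [prob, reindex, submatrix_mulVec_equiv, Function.comp_assoc, Equiv.self_comp_symm,
    Function.comp_id]
  congr 1
  exact Equiv.sum_comp e fun x => star (v.ofLp x) * (M.effect b *ᵥ v.ofLp) x

/-- Measure whether a Hermitian matrix is at least `t`. -/
theorem exists_threshold {T : Matrix ι ι ℂ} (hT : T.IsHermitian) (t : ℝ) :
    ∃ M : BinaryMeasurement ι, ∀ (v : EuclideanSpace ℂ ι) (s : ℝ),
      (s ≤ t → (t - s) ^ 2 * M.prob true v ≤
        ‖WithLp.toLp 2 (T *ᵥ v.ofLp) - (s : ℂ) • v‖ ^ 2) ∧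
      (t ≤ s → (t - s) ^ 2 * M.prob false v ≤
        ‖WithLp.toLp 2 (T *ᵥ v.ofLp) - (s : ℂ) • v‖ ^ 2) := by
  set e := hT.eigenvectorBasis
  set l := hT.eigenvalues
  let P : Bool → Matrix ι ι ℂ := fun b =>
    ∑ k with decide (t ≤ l k) = b, vecMulVec (e k).ofLp (star (e k).ofLp)
  have hsum : ∑ k, vecMulVec (e k).ofLp (star (e k).ofLp) = (1 : Matrix ι ι ℂ) := by
    ext x y
    have := e.sum_inner_mul_inner (EuclideanSpace.single x 1) (EuclideanSpace.single y 1)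
    simpa [Matrix.sum_apply, vecMulVec_apply, Matrix.one_apply, EuclideanSpace.inner_single_left,
      EuclideanSpace.inner_single_right, Pi.single_apply, eq_comm] using this
  refine ⟨⟨P, fun b => posSemidef_sum _ fun k _ => posSemidef_vecMulVec_self_star _, ?_⟩, ?_⟩
  · rw [← hsum, Fintype.sum_bool]
    simp only [P, decide_eq_true_eq, decide_eq_false_iff_not]
    exact Finset.sum_filter_add_sum_filter_not _ _ _
  intro v s
  have hprob : ∀ b, (star v.ofLp ⬝ᵥ (P b *ᵥ v.ofLp)).re =
      ∑ k with decide (t ≤ l k) = b, ‖inner ℂ (e k) v‖ ^ 2 := by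
    intro b
    simp only [P, sum_mulVec, dotProduct_sum, Complex.re_sum]
    refine Finset.sum_congr rfl fun k _ => ?_
    rw [vecMulVec_mulVec, dotProduct_smul, dotProduct_comm (star _) v.ofLp,
      ← EuclideanSpace.inner_eq_star_dotProduct, dotProduct_comm,
      ← EuclideanSpace.inner_eq_star_dotProduct]
    simp only [MulOpposite.smul_eq_mul_unop, MulOpposite.unop_op]
    rw [← inner_conj_symm v, Complex.conj_mul']
    norm_cast
  -- Parseval in the eigenbasis: this is the second moment about s of the spectral distribution of T
  -- in v.
  have hnorm : ‖WithLp.toLp 2 (T *ᵥ v.ofLp) - (s : ℂ) • v‖ ^ 2 =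
      ∑ k, (l k - s) ^ 2 * ‖inner ℂ (e k) v‖ ^ 2 := by
    rw [← e.sum_sq_norm_inner_right]
    refine Finset.sum_congr rfl fun k _ => ?_
    have h1 : inner ℂ (e k) (WithLp.toLp 2 (T *ᵥ v.ofLp)) = (l k : ℂ) * inner ℂ (e k) v := by
      rw [EuclideanSpace.inner_eq_star_dotProduct, EuclideanSpace.inner_eq_star_dotProduct,
        dotProduct_comm, dotProduct_mulVec]
      have h2 : star (e k).ofLp ᵥ* T = (l k : ℂ) • star (e k).ofLp := by
        have h3 := congrArg star (hT.mulVec_eigenvectorBasis k)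
        rw [star_mulVec, hT.eq] at h3
        rw [h3]
        ext x
        simp [e, l]
      rw [h2, smul_dotProduct, dotProduct_comm, smul_eq_mul]
    rw [inner_sub_right, inner_smul_right, h1, ← sub_mul, norm_mul, mul_pow,
      ← Complex.ofReal_sub, Complex.norm_real, Real.norm_eq_abs, sq_abs]
  rw [prob, prob, hprob, hprob, hnorm, Finset.mul_sum, Finset.mul_sum]
  constructor <;> intro hs
  all_goals
    -- Chebyshev: eigenvalues on the far side of t from s satisfy (t - s)² ≤ (l k - s)², and the
    -- remaining terms of the second moment are nonnegative.
    refine (Finset.sum_le_sum fun k hk => ?_).trans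
      (Finset.sum_le_sum_of_subset_of_nonneg (Finset.filter_subset _ _) fun _ _ _ => by positivity)
    simp only [Finset.mem_filter, Finset.mem_univ, true_and, decide_eq_true_eq,
      decide_eq_false_iff_not, not_le] at hk
    refine mul_le_mul_of_nonneg_right ?_ (by positivity)
    nlinarith

end BinaryMeasurement

end Measurement

/-! ### Tensor products in coordinates. -/

section Tensor

variable {ι κ α β : Type*} [Fintype ι] [DecidableEq ι] [Fintype κ] [DecidableEq κ]
  [Fintype α] [Fintype β]

/-- The tensor product of a family of vectors, in coordinates. -/
noncomputable def piTensor (f : κ → EuclideanSpace ℂ ι) : EuclideanSpace ℂ (κ → ι) :=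
  WithLp.toLp 2 fun x => ∏ i, f i (x i)

/-- The tensor product of two vectors, in coordinates. -/
noncomputable def pairTensor (a : EuclideanSpace ℂ α) (b : EuclideanSpace ℂ β) :
    EuclideanSpace ℂ (α × β) :=
  WithLp.toLp 2 fun x => a x.1 * b x.2

/-- The tensor product of a family of matrices, in coordinates. -/
def piMatrix (A : κ → Matrix ι ι ℂ) : Matrix (κ → ι) (κ → ι) ℂ :=
  Matrix.of fun x y => ∏ i, A i (x i) (y i)

omit [DecidableEq ι] in
theorem inner_piTensor (f g : κ → EuclideanSpace ℂ ι) :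
    inner ℂ (piTensor f) (piTensor g) = ∏ i, inner ℂ (f i) (g i) := by
  simp only [EuclideanSpace.inner_eq_star_dotProduct, dotProduct, piTensor, Fintype.prod_sum,
    Pi.star_apply, star_prod, ← Finset.prod_mul_distrib]

theorem inner_pairTensor (a a' : EuclideanSpace ℂ α) (b b' : EuclideanSpace ℂ β) :
    inner ℂ (pairTensor a b) (pairTensor a' b') = inner ℂ a a' * inner ℂ b b' := by
  simp only [EuclideanSpace.inner_eq_star_dotProduct, dotProduct, pairTensor, Fintype.sum_mul_sum,
    Fintype.sum_prod_type, Pi.star_apply, star_mul']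
  exact Finset.sum_congr rfl fun _ _ => Finset.sum_congr rfl fun _ _ => by ring

theorem copies_eq_pairTensor {d : ℕ} (n₁ n₂ : ℕ) (ψ₁ ψ₂ : EuclideanSpace ℂ (Fin d)) :
    copies n₁ n₂ ψ₁ ψ₂ = pairTensor (piTensor fun _ => ψ₁) (piTensor fun _ => ψ₂) := rfl

theorem inner_copies {d : ℕ} (n₁ n₂ : ℕ) (ψ₁ ψ₂ φ₁ φ₂ : EuclideanSpace ℂ (Fin d)) :
    inner ℂ (copies n₁ n₂ ψ₁ ψ₂) (copies n₁ n₂ φ₁ φ₂) =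
      inner ℂ ψ₁ φ₁ ^ n₁ * inner ℂ ψ₂ φ₂ ^ n₂ := by
  simp [copies_eq_pairTensor, inner_pairTensor, inner_piTensor]

theorem norm_copies {d : ℕ} (n₁ n₂ : ℕ) {ψ₁ ψ₂ : EuclideanSpace ℂ (Fin d)}
    (h₁ : ‖ψ₁‖ = 1) (h₂ : ‖ψ₂‖ = 1) : ‖copies n₁ n₂ ψ₁ ψ₂‖ = 1 := by
  have h : (‖copies n₁ n₂ ψ₁ ψ₂‖ : ℂ) ^ 2 = 1 := by
    have := inner_self_eq_norm_sq_to_K (𝕜 := ℂ) (copies n₁ n₂ ψ₁ ψ₂)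
    rw [inner_copies, inner_self_eq_norm_sq_to_K, inner_self_eq_norm_sq_to_K, h₁, h₂] at this
    simpa using this.symm
  have h' : ‖copies n₁ n₂ ψ₁ ψ₂‖ ^ 2 = 1 := by exact_mod_cast h
  exact (pow_eq_one_iff_of_nonneg (norm_nonneg _) two_ne_zero).mp h'

omit [DecidableEq ι] in
theorem piMatrix_mul (A B : κ → Matrix ι ι ℂ) :
    piMatrix A * piMatrix B = piMatrix fun i => A i * B i := by
  ext x y
  simp only [piMatrix, mul_apply, of_apply, Fintype.prod_sum, ← Finset.prod_mul_distrib]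

omit [Fintype ι] [DecidableEq ι] [DecidableEq κ] in
theorem conjTranspose_piMatrix (A : κ → Matrix ι ι ℂ) :
    (piMatrix A)ᴴ = piMatrix fun i => (A i)ᴴ := by
  ext x y
  simp [piMatrix, conjTranspose_apply]

omit [DecidableEq ι] in
theorem piMatrix_mulVec_piTensor (A : κ → Matrix ι ι ℂ) (f : κ → EuclideanSpace ℂ ι) :
    WithLp.toLp 2 (piMatrix A *ᵥ (piTensor f).ofLp) =
      piTensor fun i => WithLp.toLp 2 (A i *ᵥ (f i).ofLp) := by
  ext x
  simp only [piMatrix, piTensor, mulVec, dotProduct, of_apply, Fintype.prod_sum,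
    ← Finset.prod_mul_distrib]

/-- A tensor product of matrices Bᴴ * B is again of this form. -/
theorem posSemidef_piMatrix {A : κ → Matrix ι ι ℂ} (hA : ∀ i, (A i).PosSemidef) :
    (piMatrix A).PosSemidef := by
  choose B hB using fun i => (hA i).exists_eq_conjTranspose_mul_self
  rw [funext hB, ← piMatrix_mul, ← conjTranspose_piMatrix]
  exact posSemidef_conjTranspose_mul_self _

omit [DecidableEq ι] in
theorem star_piTensor_dotProduct_piMatrix_mulVec (A : κ → Matrix ι ι ℂ)
    (f : κ → EuclideanSpace ℂ ι) :
    star (piTensor f).ofLp ⬝ᵥ (piMatrix A *ᵥ (piTensor f).ofLp) =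
      ∏ i, star (f i).ofLp ⬝ᵥ (A i *ᵥ (f i).ofLp) := by
  have h := inner_piTensor f fun i => WithLp.toLp 2 (A i *ᵥ (f i).ofLp)
  rw [← piMatrix_mulVec_piTensor] at h
  simpa only [EuclideanSpace.inner_eq_star_dotProduct, dotProduct_comm] using h

/-! ### Amplification by majority vote. -/

namespace BinaryMeasurement

theorem ofReal_prob (M : BinaryMeasurement ι) (b : Bool) (v : EuclideanSpace ℂ ι) :
    (M.prob b v : ℂ) = star v.ofLp ⬝ᵥ (M.effect b *ᵥ v.ofLp) := by
  obtain ⟨B, hB⟩ := (M.posSemidef b).exists_eq_conjTranspose_mul_self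
  rw [M.prob_eq_norm_sq hB, hB, star_dotProduct_conjTranspose_mul_self_mulVec,
    inner_self_eq_norm_sq_to_K]
  norm_cast

/-- Measure each of `k` systems with `M` and output the majority of the outcomes. -/
def majority (M : BinaryMeasurement ι) (k : ℕ) : BinaryMeasurement (Fin k → ι) where
  effect b := ∑ s : Fin k → Bool with
    decide (k ≤ 2 * Finset.card {i | s i = true}) = b, piMatrix fun i => M.effect (s i)
  posSemidef b := posSemidef_sum _ fun s _ => posSemidef_piMatrix fun i => M.posSemidef (s i)
  sum_eq_one := by
    rw [Fintype.sum_bool]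
    simp only [decide_eq_true_eq, decide_eq_false_iff_not]
    rw [Finset.sum_filter_add_sum_filter_not]
    ext x y
    have h : ∀ i, ∑ b, M.effect b (x i) (y i) = (1 : Matrix ι ι ℂ) (x i) (y i) := fun i => by
      rw [← M.sum_eq_one, Matrix.sum_apply]
    simp only [Matrix.sum_apply, piMatrix, of_apply]
    -- Summed over all outcome strings, the product effects factor into a tensor product of
    -- identities.
    rw [← Fintype.prod_sum fun i b => M.effect b (x i) (y i), Finset.prod_congr rfl fun i _ => h i]
    simp only [one_apply, Finset.prod_ite_zero, Finset.mem_univ, true_implies, funext_iff,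
      Finset.prod_const_one]

theorem prob_majority (M : BinaryMeasurement ι) (k : ℕ) (b : Bool) (v : EuclideanSpace ℂ ι) :
    (M.majority k).prob b (piTensor fun _ => v) = ∑ s : Fin k → Bool with
      decide (k ≤ 2 * Finset.card {i | s i = true}) = b, ∏ i, M.prob (s i) v := by
  apply Complex.ofReal_injective
  push_cast
  simp only [ofReal_prob, majority, sum_mulVec, dotProduct_sum,
    star_piTensor_dotProduct_piMatrix_mulVec]

/-- Union bound: each of the at most 2^k strings voting for b has b in at least half of its places
(a tie votes `true`), so its probability is at most (1/64)^(k/2) = (1/8)^k. -/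
theorem prob_majority_le (M : BinaryMeasurement ι) (k : ℕ) {b : Bool} {v : EuclideanSpace ℂ ι}
    (hv : ‖v‖ = 1) (h : M.prob b v ≤ 1 / 64) :
    (M.majority k).prob b (piTensor fun _ => v) ≤ (1 / 4) ^ k := by
  have hone : ∀ b', M.prob b' v ≤ 1 := by
    have := M.prob_false_add_prob_true v
    rw [hv] at this
    intro b'
    cases b' <;> linarith [M.prob_nonneg false v, M.prob_nonneg true v]
  have hterm : ∀ s : Fin k → Bool, decide (k ≤ 2 * Finset.card {i | s i = true}) = b →
      ∏ i, M.prob (s i) v ≤ (1 / 8 : ℝ) ^ k := by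
    intro s hs
    have hcard : k ≤ 2 * Finset.card {i | s i = b} := by
      have htot := Finset.card_filter_add_card_filter_not (s := (Finset.univ : Finset (Fin k)))
        (fun i => s i = true)
      simp only [Finset.card_univ, Fintype.card_fin, Bool.not_eq_true] at htot
      cases b <;> simp at hs <;> omega
    calc ∏ i, M.prob (s i) v ≤ ∏ i, if s i = b then (1 / 64 : ℝ) else 1 := by
          refine Finset.prod_le_prod (fun i _ => M.prob_nonneg _ _) fun i _ => ?_
          split_ifs with hi
          · rwa [hi]
          · exact hone _
      _ = (1 / 8 : ℝ) ^ (2 * Finset.card {i | s i = b}) := by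
          rw [Finset.prod_ite, Finset.prod_const, Finset.prod_const_one, mul_one, pow_mul]
          norm_num
      _ ≤ (1 / 8 : ℝ) ^ k := pow_le_pow_of_le_one (by norm_num) (by norm_num) hcard
  rw [prob_majority]
  calc _ ≤ ∑ _s : Fin k → Bool, (1 / 8 : ℝ) ^ k :=
        (Finset.sum_le_sum fun s hs => hterm s (Finset.mem_filter.mp hs).2).trans
          (Finset.sum_le_sum_of_subset_of_nonneg (Finset.filter_subset _ _)
            fun _ _ _ => by positivity)
    _ = (1 / 4) ^ k := by
        rw [Finset.sum_const, Finset.card_univ, Fintype.card_fun, Fintype.card_bool,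
          Fintype.card_fin, nsmul_eq_mul]
        push_cast
        rw [← mul_pow]
        norm_num

end BinaryMeasurement

end Tensor

/-! ### Lower bounds from overlaps. -/

section LowerBound

theorem exists_log_le_neg_log_four_mul {ε₀ : ℝ} (h0 : 0 < ε₀) (h1 : ε₀ < 1 / 2) :
    ∃ c : ℝ, 0 < c ∧ ∀ ε : ℝ, 0 < ε → ε ≤ ε₀ →
      c * Real.log (1 / ε) ≤ -Real.log (4 * ε * (1 - ε)) := by
  have hq : 0 < -Real.log (4 * ε₀ * (1 - ε₀)) := by
    have := Real.log_neg (x := 4 * ε₀ * (1 - ε₀)) (by nlinarith) (by nlinarith)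
    linarith
  have h16 : 0 < Real.log 16 := Real.log_pos (by norm_num)
  set q := -Real.log (4 * ε₀ * (1 - ε₀)) with hqdef
  refine ⟨min (1 / 2) (q / Real.log 16), by positivity, fun ε hε hle => ?_⟩
  rw [one_div ε, Real.log_inv]
  have hlog : Real.log ε ≤ 0 := Real.log_nonpos hε.le (by linarith)
  -- For ε ≤ 1/16, (4ε)² ≤ ε, whence 4ε(1 - ε) ≤ √ε and c = 1/2 works. Above 1/16, log(1/ε) is at
  -- most log 16, while 4ε(1 - ε) is at most its value at ε₀ by monotonicity below 1/2.
  by_cases hs : ε ≤ 1 / 16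
  · have hε1 : 0 < 1 - ε := by linarith
    have h4 : Real.log (4 * ε * (1 - ε)) ≤ Real.log ε / 2 := by
      have : Real.log (4 * ε * (1 - ε)) ≤ Real.log (√ε) := by
        apply Real.log_le_log (by positivity)
        apply Real.le_sqrt_of_sq_le
        have : (4 * ε * (1 - ε)) ^ 2 ≤ (4 * ε) ^ 2 := by
          apply pow_le_pow_left₀ (by positivity)
          nlinarith
        nlinarith
      rwa [Real.log_sqrt hε.le] at this
    have := mul_le_mul_of_nonneg_right (min_le_left (1 / 2) (q / Real.log 16))
      (neg_nonneg.mpr hlog)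
    linarith
  · push Not at hs
    have h5 : -Real.log ε ≤ Real.log 16 := by
      rw [← Real.log_inv]
      apply Real.log_le_log (by positivity)
      rw [inv_le_comm₀ hε (by norm_num)]
      linarith
    have h6 : Real.log (4 * ε * (1 - ε)) ≤ -q := by
      rw [hqdef, neg_neg]
      apply Real.log_le_log (by nlinarith) (by nlinarith)
    calc _ ≤ q / Real.log 16 * Real.log 16 :=
          mul_le_mul (min_le_right _ _) h5 (neg_nonneg.mpr hlog) (by positivity)
      _ = q := by field_simp
      _ ≤ _ := by linarith

/-- Rotating the second vector of an orthonormal pair towards the first. -/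
theorem exists_rotated_pair {d : ℕ} (hd : 2 ≤ d) {w : ℝ} (hw : 0 ≤ w) (hw1 : w ≤ 1) :
    ∃ e f g : EuclideanSpace ℂ (Fin d), ‖e‖ = 1 ∧ ‖f‖ = 1 ∧ ‖g‖ = 1 ∧ inner ℂ e f = 0 ∧
      inner ℂ e g = (√w : ℂ) ∧ inner ℂ f g = (√(1 - w) : ℂ) := by
  let i : Fin d := ⟨0, by omega⟩
  let j : Fin d := ⟨1, by omega⟩
  have hij : i ≠ j := by simp [i, j]
  let e : EuclideanSpace ℂ (Fin d) := EuclideanSpace.single i 1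
  let f : EuclideanSpace ℂ (Fin d) := EuclideanSpace.single j 1
  have he : ‖e‖ = 1 := by simp [e]
  have hf : ‖f‖ = 1 := by simp [f]
  have hef : inner ℂ e f = 0 := by simp [e, f, EuclideanSpace.inner_single_left, hij]
  have hfe : inner ℂ f e = 0 := inner_eq_zero_symm.mp hef
  have hee : inner ℂ e e = 1 := by rw [inner_self_eq_norm_sq_to_K, he]; simp
  have hff : inner ℂ f f = 1 := by rw [inner_self_eq_norm_sq_to_K, hf]; simp
  refine ⟨e, f, (√w : ℂ) • e + (√(1 - w) : ℂ) • f, he, hf, ?_, hef, ?_, ?_⟩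
  · have h : ‖(√w : ℂ) • e + (√(1 - w) : ℂ) • f‖ ^ 2 = 1 := by
      rw [sq, norm_add_sq_eq_norm_sq_add_norm_sq_of_inner_eq_zero (𝕜 := ℂ) _ _
        (by rw [inner_smul_left, inner_smul_right, hef]; simp), norm_smul, norm_smul, he, hf]
      simp only [Complex.norm_real, Real.norm_eq_abs, mul_one, abs_mul_abs_self]
      rw [Real.mul_self_sqrt hw, Real.mul_self_sqrt (by linarith)]
      ring
    exact (pow_eq_one_iff_of_nonneg (norm_nonneg _) two_ne_zero).mp h
  · rw [inner_add_right, inner_smul_right, inner_smul_right, hee, hef]; simp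
  · rw [inner_add_right, inner_smul_right, inner_smul_right, hfe, hff]; simp

theorem BinaryMeasurement.TestsOrthogonality.overlap_le {d n₁ n₂ : ℕ} {w ε : ℝ}
    {M : BinaryMeasurement (CopyIndex d n₁ n₂)} (hM : M.TestsOrthogonality w ε) (hε : ε ≤ 1 / 2)
    {ψ₁ ψ₂ φ₁ φ₂ : EuclideanSpace ℂ (Fin d)} (hψ₁ : ‖ψ₁‖ = 1) (hψ₂ : ‖ψ₂‖ = 1)
    (hφ₁ : ‖φ₁‖ = 1) (hφ₂ : ‖φ₂‖ = 1) (hψ : inner ℂ ψ₁ ψ₂ = 0)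
    (hφ : w ≤ ‖inner ℂ φ₁ φ₂‖ ^ 2) :
    (‖inner ℂ ψ₁ φ₁‖ ^ 2) ^ n₁ * (‖inner ℂ ψ₂ φ₂‖ ^ 2) ^ n₂ ≤ 4 * ε * (1 - ε) := by
  have h := M.norm_inner_sq_le_of_distinguishes (norm_copies n₁ n₂ hψ₁ hψ₂)
    (norm_copies n₁ n₂ hφ₁ hφ₂) hε ((hM ψ₁ ψ₂ hψ₁ hψ₂).1 (by rw [hψ, norm_zero]))
    ((hM φ₁ φ₂ hφ₁ hφ₂).2 hφ)
  rw [inner_copies, norm_mul, norm_pow, norm_pow, mul_pow] at h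
  rwa [← pow_mul, ← pow_mul, mul_comm 2, mul_comm 2, pow_mul, pow_mul]

/-- The unrotated state is common to both joint states and contributes a factor 1, so only the
copies of the rotated one count. -/
theorem OrthogonalityTestable.pow_le {d n₁ n₂ : ℕ} {w ε : ℝ}
    (h : OrthogonalityTestable d n₁ n₂ w ε) (hd : 2 ≤ d) (hw : 0 ≤ w) (hw1 : w ≤ 1)
    (hε : ε ≤ 1 / 2) :
    (1 - w) ^ n₁ ≤ 4 * ε * (1 - ε) ∧ (1 - w) ^ n₂ ≤ 4 * ε * (1 - ε) := by
  obtain ⟨M, hM⟩ := h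
  obtain ⟨e, f, g, he, hf, hg, hef, heg, hfg⟩ := exists_rotated_pair hd hw hw1
  have hns : ∀ x : ℝ, 0 ≤ x → ‖(√x : ℂ)‖ ^ 2 = x := fun x hx => by
    rw [Complex.norm_real, Real.norm_eq_abs, sq_abs, Real.sq_sqrt hx]
  have hge : ‖inner ℂ g e‖ ^ 2 = w := by rw [norm_inner_symm, heg, hns w hw]
  constructor
  · have := hM.overlap_le hε hf he hg he (inner_eq_zero_symm.mp hef) hge.ge
    rw [hfg, hns (1 - w) (by linarith)] at this
    simpa [he] using this
  · have := hM.overlap_le hε he hf he hg hef (by rw [heg, hns w hw])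
    rw [hfg, hns (1 - w) (by linarith)] at this
    simpa [he] using this

/-- The pair (g, g), with g the bisector of e and f, has overlap 1 and so must be accepted for every
w ≤ 1. -/
theorem OrthogonalityTestable.half_pow_le {d n₁ n₂ : ℕ} {w ε : ℝ}
    (h : OrthogonalityTestable d n₁ n₂ w ε) (hd : 2 ≤ d) (hw1 : w ≤ 1) (hε : ε ≤ 1 / 2) :
    (1 / 2 : ℝ) ^ (n₁ + n₂) ≤ 4 * ε * (1 - ε) := by
  obtain ⟨M, hM⟩ := h
  obtain ⟨e, f, g, he, hf, hg, hef, heg, hfg⟩ :=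
    exists_rotated_pair hd (w := 1 / 2) (by norm_num) (by norm_num)
  have hns : ‖(√(1 / 2) : ℂ)‖ ^ 2 = 1 / 2 := by
    rw [Complex.norm_real, Real.norm_eq_abs, sq_abs, Real.sq_sqrt (by norm_num)]
  have := hM.overlap_le hε he hf hg hg hef (by simpa [hg] using hw1)
  rw [heg, hfg, show (1 : ℝ) - 1 / 2 = 1 / 2 by norm_num, hns, ← pow_add] at this
  exact this

/-- Take logarithms and use -log(1 - w) ≤ w/(1 - w) ≤ w/(1 - w₀). -/
theorem le_mul_copies_of_pow_le {c w w₀ ε : ℝ} {n : ℕ} (hw : 0 < w) (hw0 : w ≤ w₀) (hw1 : w₀ < 1)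
    (hlog : c * Real.log (1 / ε) ≤ -Real.log (4 * ε * (1 - ε)))
    (h : (1 - w) ^ n ≤ 4 * ε * (1 - ε)) :
    c * (1 - w₀) * (Real.log (1 / ε) / w) ≤ n := by
  have hp : 0 < 1 - w := by linarith
  have h1 := Real.log_le_log (by positivity) h
  rw [Real.log_pow] at h1
  have h2 := Real.one_sub_inv_le_log_of_pos hp
  have h3 : -Real.log (1 - w) ≤ w / (1 - w₀) := by
    have : (1 - w)⁻¹ - 1 = w / (1 - w) := by
      rw [eq_div_iff hp.ne', sub_mul, inv_mul_cancel₀ hp.ne']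
      ring
    have : w / (1 - w) ≤ w / (1 - w₀) := by gcongr
    linarith
  have hp0 : 0 < 1 - w₀ := by linarith
  have h4 : c * Real.log (1 / ε) ≤ n * (w / (1 - w₀)) := by
    nlinarith [mul_le_mul_of_nonneg_left h3 (Nat.cast_nonneg n : (0 : ℝ) ≤ n)]
  calc c * (1 - w₀) * (Real.log (1 / ε) / w) = c * Real.log (1 / ε) * ((1 - w₀) / w) := by ring
    _ ≤ n * (w / (1 - w₀)) * ((1 - w₀) / w) := by gcongr
    _ = n := by field_simp

theorem exists_each_lower_bound {ε₀ w₀ : ℝ} (hε₀ : 0 < ε₀) (hε₀' : ε₀ < 1 / 2) (hw₀ : w₀ < 1) :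
    ∃ c : ℝ, 0 < c ∧ ∀ (d n₁ n₂ : ℕ) (w ε : ℝ), 2 ≤ d → 0 < w → w ≤ w₀ → 0 < ε → ε ≤ ε₀ →
      OrthogonalityTestable d n₁ n₂ w ε →
        c * (Real.log (1 / ε) / w) ≤ (n₁ : ℝ) ∧ c * (Real.log (1 / ε) / w) ≤ (n₂ : ℝ) := by
  obtain ⟨c, hc, hlog⟩ := exists_log_le_neg_log_four_mul hε₀ hε₀'
  refine ⟨c * (1 - w₀), mul_pos hc (by linarith), fun d n₁ n₂ w ε hd hw hw' hε hε' h => ?_⟩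
  have := h.pow_le hd hw.le (by linarith) (by linarith)
  exact ⟨le_mul_copies_of_pow_le hw hw' hw₀ (hlog ε hε hε') this.1,
    le_mul_copies_of_pow_le hw hw' hw₀ (hlog ε hε hε') this.2⟩

theorem exists_total_lower_bound {ε₀ : ℝ} (hε₀ : 0 < ε₀) (hε₀' : ε₀ < 1 / 2) :
    ∃ c : ℝ, 0 < c ∧ ∀ (d n₁ n₂ : ℕ) (w ε : ℝ), 2 ≤ d → 0 < w → w ≤ 1 → 0 < ε → ε ≤ ε₀ →
      OrthogonalityTestable d n₁ n₂ w ε → c * (Real.log (1 / ε) / w) ≤ (n₁ : ℝ) + n₂ := by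
  obtain ⟨c, hc, hlog⟩ := exists_log_le_neg_log_four_mul hε₀ hε₀'
  refine ⟨c * (1 - 1 / 2), mul_pos hc (by norm_num), fun d n₁ n₂ w ε hd hw hw1 hε hε' h => ?_⟩
  rcases le_or_gt w (1 / 2) with hw2 | hw2
  · have := le_mul_copies_of_pow_le hw hw2 (by norm_num) (hlog ε hε hε')
      (h.pow_le hd hw.le hw1 (by linarith)).1
    have h2 : (0 : ℝ) ≤ n₂ := Nat.cast_nonneg _
    linarith
  -- For w > 1/2 the bisector bound has the form (1 - 1/2)^(n₁ + n₂), so the same estimate applies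
  -- at 1/2, and 1/w ≤ 1/(1/2).
  · have h1 := le_mul_copies_of_pow_le (w := 1 / 2) (by norm_num) le_rfl (by norm_num)
      (hlog ε hε hε') (n := n₁ + n₂)
      (by simpa [show (1 : ℝ) - 2⁻¹ = 2⁻¹ by norm_num] using h.half_pow_le hd hw1 (by linarith))
    push_cast at h1
    refine le_trans ?_ h1
    have : 0 ≤ Real.log (1 / ε) := Real.log_nonneg (by rw [le_div_iff₀ hε]; linarith)
    gcongr

end LowerBound

/-! ### The exchange observable and its first two moments. -/

section Exchange

variable {d n₁ n₂ : ℕ}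

/-- Exchange the `i`-th system of the first group with the `j`-th system of the second. -/
def exchange (i : Fin n₁) (j : Fin n₂) (x : CopyIndex d n₁ n₂) : CopyIndex d n₁ n₂ :=
  (Function.update x.1 i (x.2 j), Function.update x.2 j (x.1 i))

theorem exchange_involutive (i : Fin n₁) (j : Fin n₂) :
    Function.Involutive (exchange (d := d) i j) := fun x => by
  simp [exchange]

/-- The sum of all exchanges of a system of the first group with one of the second. -/
def exchangeSum (d n₁ n₂ : ℕ) : Matrix (CopyIndex d n₁ n₂) (CopyIndex d n₁ n₂) ℂ :=
  Matrix.of fun x y => ∑ i, ∑ j, if exchange i j x = y then 1 else 0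

theorem isHermitian_exchangeSum : (exchangeSum d n₁ n₂).IsHermitian := by
  ext x y
  simp only [exchangeSum, conjTranspose_apply, of_apply, star_sum]
  refine Finset.sum_congr rfl fun i _ => Finset.sum_congr rfl fun j _ => ?_
  rw [apply_ite star, star_one, star_zero]
  exact if_congr ((exchange_involutive i j).eq_iff.trans eq_comm) rfl rfl

theorem exchangeSum_mulVec (v : CopyIndex d n₁ n₂ → ℂ) (x : CopyIndex d n₁ n₂) :
    (exchangeSum d n₁ n₂ *ᵥ v) x = ∑ i, ∑ j, v (exchange i j x) := by
  simp only [exchangeSum, mulVec, dotProduct, of_apply, Finset.sum_mul, ite_mul, one_mul, zero_mul]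
  rw [Finset.sum_comm]
  refine Finset.sum_congr rfl fun i _ => ?_
  rw [Finset.sum_comm]
  simp

/-- The sum over all positions of `ψ^{⊗ n}` with one factor replaced by `φ`. -/
noncomputable def sumReplaced (n : ℕ) (ψ φ : EuclideanSpace ℂ (Fin d)) :
    EuclideanSpace ℂ (Fin n → Fin d) :=
  ∑ i, piTensor (Function.update (fun _ => ψ) i φ)

theorem prod_apply_update {n : ℕ} (f : Fin d → ℂ) (x : Fin n → Fin d) (i : Fin n) (a : Fin d) :
    ∏ p, f (Function.update x i a p) = f a * ∏ p ∈ Finset.univ \ {i}, f (x p) := by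
  rw [← Finset.prod_update_of_mem (Finset.mem_univ i) fun p => f (x p)]
  refine Finset.prod_congr rfl fun p _ => ?_
  by_cases h : p = i
  · subst h; simp
  · simp [h]

theorem piTensor_update_apply {n : ℕ} (ψ φ : EuclideanSpace ℂ (Fin d)) (i : Fin n)
    (x : Fin n → Fin d) :
    piTensor (Function.update (fun _ => ψ) i φ) x =
      φ (x i) * ∏ p ∈ Finset.univ \ {i}, ψ (x p) := by
  rw [← Finset.prod_update_of_mem (Finset.mem_univ i) fun p => ψ (x p)]
  change ∏ p, (Function.update (fun _ => ψ) i φ p) (x p) = _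
  refine Finset.prod_congr rfl fun p _ => ?_
  by_cases h : p = i
  · subst h; simp
  · simp [h]

/-- Exchange (i, j) puts ψ₂ at place i and ψ₁ at place j, independently, so the double sum factors.
This makes the second moment computable. -/
theorem exchangeSum_mulVec_copies (ψ₁ ψ₂ : EuclideanSpace ℂ (Fin d)) :
    WithLp.toLp 2 (exchangeSum d n₁ n₂ *ᵥ (copies n₁ n₂ ψ₁ ψ₂).ofLp) =
      pairTensor (sumReplaced n₁ ψ₁ ψ₂) (sumReplaced n₂ ψ₂ ψ₁) := by
  ext x
  simp only [exchangeSum_mulVec, pairTensor, sumReplaced, WithLp.ofLp_sum, Finset.sum_apply,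
    Fintype.sum_mul_sum]
  refine Finset.sum_congr rfl fun i _ => Finset.sum_congr rfl fun j _ => ?_
  simp only [piTensor_update_apply, copies, exchange, prod_apply_update]
  ring

theorem inner_piTensor_sumReplaced {n : ℕ} {ψ : EuclideanSpace ℂ (Fin d)} (hψ : ‖ψ‖ = 1)
    (φ : EuclideanSpace ℂ (Fin d)) :
    inner ℂ (piTensor fun _ => ψ) (sumReplaced n ψ φ) = n * inner ℂ ψ φ := by
  have hψψ : inner ℂ ψ ψ = 1 := by rw [inner_self_eq_norm_sq_to_K, hψ]; simp
  have h : ∀ i : Fin n, inner ℂ (piTensor fun _ => ψ)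
      (piTensor (Function.update (fun _ => ψ) i φ)) = inner ℂ ψ φ := fun i => by
    rw [inner_piTensor, Finset.prod_eq_single i]
    · simp
    · intro p _ hp; simp [hp, hψ]
    · simp
  rw [sumReplaced, inner_sum, Finset.sum_congr rfl fun i _ => h i]
  simp

/-- The Gram matrix of the n summands has 1 on the diagonal and |⟨ψ|φ⟩|² off it. -/
theorem norm_sumReplaced_sq {n : ℕ} {ψ φ : EuclideanSpace ℂ (Fin d)} (hψ : ‖ψ‖ = 1)
    (hφ : ‖φ‖ = 1) :
    ‖sumReplaced n ψ φ‖ ^ 2 = n * (1 + (n - 1) * ‖inner ℂ ψ φ‖ ^ 2) := by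
  have hψψ : inner ℂ ψ ψ = 1 := by rw [inner_self_eq_norm_sq_to_K, hψ]; simp
  have hφφ : inner ℂ φ φ = 1 := by rw [inner_self_eq_norm_sq_to_K, hφ]; simp
  set a : ℂ := (‖inner ℂ ψ φ‖ : ℂ) ^ 2 with ha
  have h : ∀ i k : Fin n, inner ℂ (piTensor (Function.update (fun _ => ψ) i φ))
      (piTensor (Function.update (fun _ => ψ) k φ)) = a + if i = k then 1 - a else 0 := by
    intro i k
    rw [inner_piTensor]
    split_ifs with hik
    · subst hik
      rw [add_sub_cancel]
      refine Finset.prod_eq_one fun p _ => ?_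
      by_cases hp : p = i
      · subst hp; simpa using hφφ
      · simpa [hp] using hψψ
    · rw [Finset.prod_eq_mul i k hik]
      · rw [Function.update_self, Function.update_self, Function.update_of_ne hik,
          Function.update_of_ne (Ne.symm hik), ← inner_conj_symm, Complex.conj_mul', add_zero]
      · intro p _ hp; simp [hp.1, hp.2, hψ]
      · simp
      · simp
  have hc : (‖sumReplaced n ψ φ‖ : ℂ) ^ 2 = n * (1 + (n - 1) * a) := by
    have h0 := inner_self_eq_norm_sq_to_K (𝕜 := ℂ) (sumReplaced n ψ φ)
    have h1 : inner ℂ (sumReplaced n ψ φ) (sumReplaced n ψ φ) = n * (1 + (n - 1) * a) := by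
      simp only [sumReplaced, sum_inner, inner_sum, h, Finset.sum_add_distrib]
      simp
      ring
    rw [← h1, h0]
    rfl
  rw [ha] at hc
  apply Complex.ofReal_injective
  push_cast
  exact hc

theorem norm_pairTensor {α β : Type*} [Fintype α] [Fintype β] (a : EuclideanSpace ℂ α)
    (b : EuclideanSpace ℂ β) : ‖pairTensor a b‖ = ‖a‖ * ‖b‖ := by
  have h := inner_pairTensor a a b b
  rw [inner_self_eq_norm_sq_to_K, inner_self_eq_norm_sq_to_K, inner_self_eq_norm_sq_to_K,
    ← mul_pow] at h
  have h' : ‖pairTensor a b‖ ^ 2 = (‖a‖ * ‖b‖) ^ 2 := by exact_mod_cast h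
  exact (pow_left_inj₀ (norm_nonneg _) (by positivity) two_ne_zero).mp h'

/-- The deviation of `exchangeSum` from the value `s` on a product of copies. -/
theorem norm_exchangeSum_sub_smul_copies_sq (n : ℕ) {ψ₁ ψ₂ : EuclideanSpace ℂ (Fin d)}
    (h₁ : ‖ψ₁‖ = 1) (h₂ : ‖ψ₂‖ = 1) (s : ℝ) :
    ‖WithLp.toLp 2 (exchangeSum d n n *ᵥ (copies n n ψ₁ ψ₂).ofLp) -
        (s : ℂ) • copies n n ψ₁ ψ₂‖ ^ 2 =
      (n * (1 + (n - 1) * ‖inner ℂ ψ₁ ψ₂‖ ^ 2)) ^ 2 - 2 * s * (n ^ 2 * ‖inner ℂ ψ₁ ψ₂‖ ^ 2) +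
        s ^ 2 := by
  have hin : inner ℂ (copies n n ψ₁ ψ₂)
      (WithLp.toLp 2 (exchangeSum d n n *ᵥ (copies n n ψ₁ ψ₂).ofLp)) =
        ((n ^ 2 * ‖inner ℂ ψ₁ ψ₂‖ ^ 2 : ℝ) : ℂ) := by
    rw [exchangeSum_mulVec_copies, copies_eq_pairTensor, inner_pairTensor,
      inner_piTensor_sumReplaced h₁, inner_piTensor_sumReplaced h₂]
    have := Complex.mul_conj' (inner ℂ ψ₁ ψ₂)
    rw [inner_conj_symm] at this
    push_cast
    rw [← this]
    ring
  rw [norm_sub_sq (𝕜 := ℂ), inner_smul_right, ← inner_conj_symm, hin, exchangeSum_mulVec_copies,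
    norm_pairTensor, mul_pow, norm_sumReplaced_sq h₁ h₂, norm_sumReplaced_sq h₂ h₁,
    norm_inner_symm ψ₂ ψ₁, norm_smul, norm_copies n n h₁ h₂, Complex.conj_ofReal,
    ← Complex.ofReal_mul, mul_one, Complex.norm_real, Real.norm_eq_abs, sq_abs]
  have : RCLike.re ((s * (n ^ 2 * ‖inner ℂ ψ₁ ψ₂‖ ^ 2) : ℝ) : ℂ) =
    s * (n ^ 2 * ‖inner ℂ ψ₁ ψ₂‖ ^ 2) := Complex.ofReal_re _
  rw [this]
  ring

theorem exists_weak_tester {n : ℕ} {w : ℝ} (hw : 0 < w) (hn : 1024 ≤ n * w) (d : ℕ) :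
    ∃ M : BinaryMeasurement (CopyIndex d n n), ∀ ψ₁ ψ₂ : EuclideanSpace ℂ (Fin d),
      ‖ψ₁‖ = 1 → ‖ψ₂‖ = 1 →
      (‖inner ℂ ψ₁ ψ₂‖ = 0 → M.prob true (copies n n ψ₁ ψ₂) ≤ 1 / 64) ∧
      (w ≤ ‖inner ℂ ψ₁ ψ₂‖ ^ 2 → M.prob false (copies n n ψ₁ ψ₂) ≤ 1 / 64) := by
  have hn0 : (0 : ℝ) < n := by
    rcases (Nat.cast_nonneg n : (0 : ℝ) ≤ n).eq_or_lt with h | h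
    · rw [← h] at hn; norm_num at hn
    · exact h
  obtain ⟨M, hM⟩ := BinaryMeasurement.exists_threshold
    (isHermitian_exchangeSum (d := d) (n₁ := n) (n₂ := n)) (n ^ 2 * w / 2)
  refine ⟨M, fun ψ₁ ψ₂ h₁ h₂ => ⟨fun h => ?_, fun h => ?_⟩⟩
  · have h3 := (hM (copies n n ψ₁ ψ₂) 0).1 (by positivity)
    rw [norm_exchangeSum_sub_smul_copies_sq n h₁ h₂, h] at h3
    have hp := M.prob_nonneg true (copies n n ψ₁ ψ₂)
    generalize M.prob true (copies n n ψ₁ ψ₂) = p at *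
    -- In the orthogonal case the second moment about 0 is n², so p ≤ 4/(nw)².
    have h4 : (n : ℝ) ^ 2 * ((n * w) ^ 2 * p) ≤ n ^ 2 * 4 := by nlinarith
    have h5 := le_of_mul_le_mul_left h4 (by positivity)
    have h6 : (1024 : ℝ) ^ 2 * p ≤ (n * w) ^ 2 * p := by gcongr
    linarith
  · set a := ‖inner ℂ ψ₁ ψ₂‖ ^ 2 with ha
    have ha1 : a ≤ 1 := by
      have := norm_inner_le_norm (𝕜 := ℂ) ψ₁ ψ₂
      rw [h₁, h₂, mul_one] at this
      exact pow_le_one₀ (norm_nonneg _) this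
    have hle : (n : ℝ) ^ 2 * w ≤ n ^ 2 * a := by gcongr
    have ha0 : 0 < a := hw.trans_le h
    have h3 := (hM (copies n n ψ₁ ψ₂) (n ^ 2 * a)).2 (by
      have : 0 ≤ (n : ℝ) ^ 2 * w := by positivity
      linarith)
    rw [norm_exchangeSum_sub_smul_copies_sq n h₁ h₂, ← ha] at h3
    have hp := M.prob_nonneg false (copies n n ψ₁ ψ₂)
    generalize M.prob false (copies n n ψ₁ ψ₂) = p at *
    -- The threshold lies at least n²a/2 below the mean n²a, so everything reduces to y = na: y²p ≤
    -- 4(1 + 2y) ≤ 9y, and p ≤ 9/1024.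
    have hna : 1024 ≤ n * a := hn.trans (by gcongr)
    have h4 : (n * (n * a) / 2) ^ 2 * p ≤ (n ^ 2 * w / 2 - n ^ 2 * a) ^ 2 * p := by
      refine mul_le_mul_of_nonneg_right ?_ hp
      rw [← neg_sq (_ - _)]
      apply pow_le_pow_left₀ (by positivity)
      linarith
    have h5 : (n * (1 + (n - 1) * a)) ^ 2 - 2 * (n ^ 2 * a) * (n ^ 2 * a) + (n ^ 2 * a) ^ 2 ≤
        n ^ 2 * (1 + 2 * (n * a)) := by
      have : (n * (1 + (n - 1) * a)) ^ 2 - 2 * (n ^ 2 * a) * (n ^ 2 * a) + (n ^ 2 * a) ^ 2 =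
          n ^ 2 * (1 + 2 * (n * a)) - n ^ 2 * (a * (2 + 2 * (n * a) - a)) := by ring
      have : 0 ≤ (n : ℝ) ^ 2 * (a * (2 + 2 * (n * a) - a)) :=
        mul_nonneg (by positivity) (mul_nonneg ha0.le (by linarith))
      linarith
    have h6 : (n : ℝ) ^ 2 * ((n * a) ^ 2 * p) ≤ n ^ 2 * (4 * (1 + 2 * (n * a))) := by linarith
    have h7 := le_of_mul_le_mul_left h6 (by positivity)
    generalize (n : ℝ) * a = y at *
    have h8 : y * (y * p) ≤ y * 9 := by nlinarith
    have h9 := le_of_mul_le_mul_left h8 (by linarith)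
    have : 1024 * p ≤ y * p := by gcongr
    linarith

end Exchange

/-! ### Assembling the tester. -/

section UpperBound

/-- Split `k * n` copies of each state into `k` blocks of `n` copies. -/
def copyBlocks (d k n : ℕ) : CopyIndex d (k * n) (k * n) ≃ (Fin k → CopyIndex d n n) :=
  ((finProdFinEquiv.symm.arrowCongr (Equiv.refl _)).trans (Equiv.curry _ _ _)).prodCongr
    ((finProdFinEquiv.symm.arrowCongr (Equiv.refl _)).trans (Equiv.curry _ _ _)) |>.trans
    (Equiv.arrowProdEquivProdArrow (Fin k) _ _).symm

theorem copies_mul (d k n : ℕ) (ψ₁ ψ₂ : EuclideanSpace ℂ (Fin d)) :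
    copies (k * n) (k * n) ψ₁ ψ₂ =
      WithLp.toLp 2 ((piTensor fun _ => copies n n ψ₁ ψ₂).ofLp ∘ copyBlocks d k n) := by
  ext x
  simp only [copies, piTensor, Function.comp_apply, Finset.prod_mul_distrib]
  rw [← finProdFinEquiv.prod_comp fun i => ψ₁ (x.1 i),
    ← finProdFinEquiv.prod_comp fun i => ψ₂ (x.2 i), Fintype.prod_prod_type,
    Fintype.prod_prod_type]
  rfl

theorem orthogonalityTestable_mul {n k : ℕ} {w ε : ℝ} (hw : 0 < w) (hn : 1024 ≤ n * w)
    (hk : (1 / 4 : ℝ) ^ k ≤ ε) (d : ℕ) : OrthogonalityTestable d (k * n) (k * n) w ε := by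
  obtain ⟨M, hM⟩ := exists_weak_tester hw hn d
  refine ⟨(M.majority k).reindex (copyBlocks d k n), fun ψ₁ ψ₂ h₁ h₂ => ?_⟩
  have hone := ((M.majority k).reindex (copyBlocks d k n)).prob_false_add_prob_true
    (copies (k * n) (k * n) ψ₁ ψ₂)
  rw [norm_copies _ _ h₁ h₂, copies_mul, BinaryMeasurement.prob_reindex,
    BinaryMeasurement.prob_reindex] at hone
  rw [copies_mul, BinaryMeasurement.prob_reindex, BinaryMeasurement.prob_reindex]
  constructor <;> intro h
  · linarith [M.prob_majority_le k (norm_copies n n h₁ h₂) ((hM ψ₁ ψ₂ h₁ h₂).1 h)]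
  · linarith [M.prob_majority_le k (norm_copies n n h₁ h₂) ((hM ψ₁ ψ₂ h₁ h₂).2 h)]

/-- Answering at random. -/
theorem orthogonalityTestable_of_half_le {w ε : ℝ} (hε : 1 / 2 ≤ ε) (d n₁ n₂ : ℕ) :
    OrthogonalityTestable d n₁ n₂ w ε := by
  have hhalf : (0 : ℂ) ≤ 1 / 2 := by rw [Complex.le_def]; norm_num
  refine ⟨⟨fun _ => (1 / 2 : ℂ) • 1, fun _ => PosSemidef.one.smul hhalf, ?_⟩,
    fun ψ₁ ψ₂ h₁ h₂ => ?_⟩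
  · rw [Fintype.sum_bool, ← add_smul]; norm_num
  have hp : ∀ M : BinaryMeasurement (CopyIndex d n₁ n₂), M.effect false = M.effect true →
      ∀ b, M.prob b (copies n₁ n₂ ψ₁ ψ₂) = 1 / 2 := fun M hM b => by
    have h := M.prob_false_add_prob_true (copies n₁ n₂ ψ₁ ψ₂)
    rw [norm_copies _ _ h₁ h₂] at h
    have h' : M.prob false (copies n₁ n₂ ψ₁ ψ₂) = M.prob true (copies n₁ n₂ ψ₁ ψ₂) := by
      rw [BinaryMeasurement.prob, BinaryMeasurement.prob, hM]
    cases b <;> linarith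
  rw [hp _ rfl, hp _ rfl]
  constructor <;> intro <;> linarith

theorem exists_upper_bound :
    ∃ C : ℝ, 0 < C ∧ ∀ w ε : ℝ, 0 < w → w ≤ 1 → 0 < ε → ε < 1 →
      ∃ n : ℕ, (n : ℝ) ≤ C * (Real.log (1 / ε) / w) ∧
        ∀ d : ℕ, OrthogonalityTestable d n n w ε := by
  -- 3075 = 3 · 1025: ⌈L⌉ ≤ 3L once L ≥ 1/2, and ⌈1024/w⌉ ≤ 1025/w since w ≤ 1.
  refine ⟨3075, by norm_num, fun w ε hw hw1 hε hε1 => ?_⟩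
  have hlog : 0 ≤ Real.log (1 / ε) := Real.log_nonneg (by rw [le_div_iff₀ hε]; linarith)
  -- As ε tends to 1 the allowed number of copies falls below 1, so for ε ≥ 1/2 no copies are used.
  rcases le_or_gt (1 / 2) ε with h | h
  · exact ⟨0, by push_cast; positivity, fun d => orthogonalityTestable_of_half_le h d 0 0⟩
  have hlog2 : 1 / 2 ≤ Real.log (1 / ε) := by
    have h2 : Real.log 2 ≤ Real.log (1 / ε) := by
      apply Real.log_le_log (by norm_num)
      rw [le_div_iff₀ hε]; linarith
    linarith [Real.log_two_gt_d9]
  set L := Real.log (1 / ε) with hL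
  refine ⟨⌈L⌉₊ * ⌈1024 / w⌉₊, ?_, fun d => orthogonalityTestable_mul hw ?_ ?_ d⟩
  · have h1 : (⌈L⌉₊ : ℝ) ≤ 3 * L := by linarith [Nat.ceil_lt_add_one hlog]
    have h2 : (⌈1024 / w⌉₊ : ℝ) ≤ 1025 / w := by
      have h3 : 1 ≤ 1 / w := by rw [le_div_iff₀ hw]; linarith
      have h4 := Nat.ceil_lt_add_one (a := 1024 / w) (by positivity)
      have h5 : 1024 / w + 1 / w = 1025 / w := by ring
      linarith
    push_cast
    calc (⌈L⌉₊ : ℝ) * ⌈1024 / w⌉₊ ≤ 3 * L * (1025 / w) := by gcongr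
      _ = 3075 * (L / w) := by ring
  · rw [← div_le_iff₀ hw]
    exact Nat.le_ceil _
  -- Since 1/4 ≤ 1/e, ⌈log(1/ε)⌉ blocks bring the error down to ε.
  · have hexp : (1 / 4 : ℝ) ≤ Real.exp (-1) := by
      rw [Real.exp_neg, one_div]
      exact inv_anti₀ (Real.exp_pos 1) (by linarith [Real.exp_one_lt_d9])
    calc (1 / 4 : ℝ) ^ ⌈L⌉₊ ≤ Real.exp (-1) ^ ⌈L⌉₊ := by gcongr
      _ = Real.exp (-⌈L⌉₊) := by rw [← Real.exp_nat_mul]; ring_nf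
      _ ≤ Real.exp (-L) := Real.exp_le_exp.mpr (neg_le_neg (Nat.le_ceil L))
      _ = ε := by rw [hL, one_div, Real.log_inv, neg_neg, Real.exp_log hε]

end UpperBound

theorem mainTheorem9 :
    -- upper bound, with an absolute constant and a number of copies independent of the dimension
    (∃ C : ℝ, 0 < C ∧ ∀ w ε : ℝ, 0 < w → w ≤ 1 → 0 < ε → ε < 1 →
      ∃ n : ℕ, (n : ℝ) ≤ C * (Real.log (1 / ε) / w) ∧
        ∀ d : ℕ, OrthogonalityTestable d n n w ε) ∧
    -- lower bound on the total number of copies, in every dimension `d ≥ 2`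
    (∀ ε₀ : ℝ, 0 < ε₀ → ε₀ < 1 / 2 → ∃ c : ℝ, 0 < c ∧
      ∀ (d n₁ n₂ : ℕ) (w ε : ℝ), 2 ≤ d → 0 < w → w ≤ 1 → 0 < ε → ε ≤ ε₀ →
        OrthogonalityTestable d n₁ n₂ w ε →
          c * (Real.log (1 / ε) / w) ≤ (n₁ : ℝ) + n₂) ∧
    -- lower bound on the number of copies of each state separately, for `w` bounded away from 1
    (∀ ε₀ w₀ : ℝ, 0 < ε₀ → ε₀ < 1 / 2 → 0 < w₀ → w₀ < 1 → ∃ c : ℝ, 0 < c ∧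
      ∀ (d n₁ n₂ : ℕ) (w ε : ℝ), 2 ≤ d → 0 < w → w ≤ w₀ → 0 < ε → ε ≤ ε₀ →
        OrthogonalityTestable d n₁ n₂ w ε →
          c * (Real.log (1 / ε) / w) ≤ (n₁ : ℝ) ∧ c * (Real.log (1 / ε) / w) ≤ (n₂ : ℝ)) :=
  ⟨exists_upper_bound, fun _ h0 h1 => exists_total_lower_bound h0 h1,
    fun _ _ h0 h1 _ h2 => exists_each_lower_bound h0 h1 h2⟩
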